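/- Let $E$ be a real Banach lattice, and let its norm dual $E^*$ carry the dual norm and the order $f\le g \iff f(x)\le g(x)$ for all $x\ge 0$ in $E$, which make it a Banach lattice. A sequence $(x_n)$ in a vector lattice is called disjoint if $|x_n|\wedge|x_m|=0$ whenever $n\neq m$. A norm bounded set $B\subseteq E^*$ is called an almost $L$-set if $\sup_{f\in B}|f(x_n)|\to 0$ for every disjoint weakly null sequence $(x_n)$ of $E$. A norm bounded subset $A$ of a Banach lattice is called $L$-weakly compact if $\|y_n\|\to 0$ for every disjoint sequence $(y_n)$ in the solid hull $\{y : |y|\le |a| \text{ for some } a\in A\}$ of $A$. A Banach lattice has order continuous norm if $\inf_{x\in D}\|x\|=0$ for every nonempty downward directed set $D$ in it with $\inf D=0$. Then every almost $L$-set in $E^*$ is $L$-weakly compact if and only if $E^*$ has order continuous norm. -/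

import Mathlib

open Filter Topology

namespace BanachLattice

/-- A sequence in a lattice-ordered group is disjoint if its terms are pairwise disjoint,
i.e. `|x n| ⊓ |x m| = 0` whenever `n ≠ m`. -/
def IsDisjointSeq {α : Type*} [Lattice α] [AddCommGroup α] (x : ℕ → α) : Prop :=
  ∀ n m, n ≠ m → |x n| ⊓ |x m| = 0

/-- A sequence in a normed space is weakly null if it converges to `0` in the weak topology. -/
def IsWeaklyNull {X : Type*} [NormedAddCommGroup X] [NormedSpace ℝ X] (x : ℕ → X) : Prop :=
  Tendsto (fun n => toWeakSpace ℝ X (x n)) atTop (𝓝 0)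

/-- A norm bounded subset `A` of a normed lattice is L-weakly compact if every disjoint sequence
in the solid hull of `A` is norm null. -/
def IsLWeaklyCompact {α : Type*} [NormedAddCommGroup α] [Lattice α] (A : Set α) : Prop :=
  Bornology.IsBounded A ∧
    ∀ x : ℕ → α, IsDisjointSeq x → (∀ n, x n ∈ LatticeOrderedAddCommGroup.solidClosure A) →
      Tendsto (fun n => ‖x n‖) atTop (𝓝 0)

/-- The norm is order continuous if `inf {‖x‖ : x ∈ D} = 0` for every nonempty downward directed
set `D` with infimum `0`. -/
def HasOrderContinuousNorm (α : Type*) [NormedAddCommGroup α] [Lattice α] : Prop :=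
  ∀ D : Set α, D.Nonempty → DirectedOn (fun a b => b ≤ a) D → IsGLB D 0 →
    IsGLB (norm '' D) 0

section Dual

variable {E : Type*} [NormedAddCommGroup E] [NormedSpace ℝ E] [Lattice E] [HasSolidNorm E]
  [IsOrderedAddMonoid E]

/-- The order of the dual: `f ≤ g` if `f x ≤ g x` for every `x ≥ 0`. -/
instance instPartialOrderDual : PartialOrder (StrongDual ℝ E) where
  le f g := ∀ x : E, 0 ≤ x → f x ≤ g x
  le_refl f x _ := le_refl (f x)
  le_trans f g h hfg hgh x hx := (hfg x hx).trans (hgh x hx)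
  le_antisymm f g hfg hgf := by
    ext x
    have h : ∀ y : E, 0 ≤ y → f y = g y := fun y hy => le_antisymm (hfg y hy) (hgf y hy)
    rw [← posPart_sub_negPart x, map_sub, map_sub, h _ (posPart_nonneg x),
      h _ (negPart_nonneg x)]

/-- The value of the positive part of `f` at `x ≥ 0`: the supremum of `f` on `[0, x]`. -/
noncomputable def coneSup (f : StrongDual ℝ E) (x : E) : ℝ := sSup (f '' Set.Icc 0 x)

theorem le_norm_of_mem_Icc (f : StrongDual ℝ E) {x y : E} (h : y ∈ Set.Icc 0 x) :
    f y ≤ ‖f‖ * ‖x‖ := by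
  refine (le_abs_self _).trans ((f.le_opNorm y).trans ?_)
  refine mul_le_mul_of_nonneg_left (HasSolidNorm.solid ?_) (norm_nonneg f)
  rw [abs_of_nonneg h.1, abs_of_nonneg (h.1.trans h.2)]
  exact h.2

theorem bddAbove_image_Icc (f : StrongDual ℝ E) (x : E) : BddAbove (f '' Set.Icc 0 x) :=
  ⟨‖f‖ * ‖x‖, by rintro _ ⟨y, hy, rfl⟩; exact le_norm_of_mem_Icc f hy⟩

theorem le_coneSup (f : StrongDual ℝ E) {x y : E} (hy : 0 ≤ y) (hyx : y ≤ x) :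
    f y ≤ coneSup f x :=
  le_csSup (bddAbove_image_Icc f x) ⟨y, ⟨hy, hyx⟩, rfl⟩

theorem coneSup_le (f : StrongDual ℝ E) {x : E} (hx : 0 ≤ x) {c : ℝ}
    (h : ∀ y, 0 ≤ y → y ≤ x → f y ≤ c) : coneSup f x ≤ c :=
  csSup_le ⟨f 0, 0, ⟨le_rfl, hx⟩, rfl⟩ (by rintro _ ⟨y, hy, rfl⟩; exact h y hy.1 hy.2)

theorem coneSup_nonneg (f : StrongDual ℝ E) {x : E} (hx : 0 ≤ x) : 0 ≤ coneSup f x := by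
  simpa using le_coneSup f le_rfl hx

theorem coneSup_le_norm (f : StrongDual ℝ E) {x : E} (hx : 0 ≤ x) :
    coneSup f x ≤ ‖f‖ * ‖x‖ :=
  coneSup_le f hx fun _ h0 h1 => le_norm_of_mem_Icc f ⟨h0, h1⟩

theorem coneSup_add (f : StrongDual ℝ E) {x y : E} (hx : 0 ≤ x) (hy : 0 ≤ y) :
    coneSup f (x + y) = coneSup f x + coneSup f y := by
  apply le_antisymm
  · refine coneSup_le f (add_nonneg hx hy) fun z hz hzxy => ?_
    have h1 : f (z ⊓ x) ≤ coneSup f x := le_coneSup f (le_inf hz hx) inf_le_right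
    have h2 : f (z - z ⊓ x) ≤ coneSup f y := by
      refine le_coneSup f (sub_nonneg.2 inf_le_left) (sub_le_comm.1 (le_inf ?_ ?_))
      · exact sub_le_self z hy
      · exact sub_le_iff_le_add.2 hzxy
    rw [map_sub] at h2
    linarith
  · rw [← le_sub_iff_add_le]
    refine coneSup_le f hx fun u hu hux => ?_
    rw [le_sub_comm]
    refine coneSup_le f hy fun v hv hvy => ?_
    have h := le_coneSup f (add_nonneg hu hv) (add_le_add hux hvy)
    rw [map_add] at h
    linarith

/-- The positive part of a functional, extended from the cone to `E` by additivity. -/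
noncomputable def dualPosAddHom (f : StrongDual ℝ E) : E →+ ℝ :=
  AddMonoidHom.mk' (fun x => coneSup f x⁺ - coneSup f x⁻) fun x y => by
    have key : (x + y)⁺ + (x⁻ + y⁻) = (x + y)⁻ + (x⁺ + y⁺) := by
      have h1 := posPart_sub_negPart (x + y)
      have h2 := posPart_sub_negPart x
      have h3 := posPart_sub_negPart y
      have h4 : (x + y)⁺ - (x + y)⁻ = (x⁺ - x⁻) + (y⁺ - y⁻) := by rw [h1, h2, h3]
      rw [sub_eq_iff_eq_add] at h4
      rw [h4]
      abel
    have h := congrArg (coneSup f) key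
    rw [coneSup_add f (posPart_nonneg _) (add_nonneg (negPart_nonneg _) (negPart_nonneg _)),
      coneSup_add f (negPart_nonneg _) (negPart_nonneg _),
      coneSup_add f (negPart_nonneg _) (add_nonneg (posPart_nonneg _) (posPart_nonneg _)),
      coneSup_add f (posPart_nonneg _) (posPart_nonneg _)] at h
    linarith

theorem continuous_dualPosAddHom (f : StrongDual ℝ E) : Continuous (dualPosAddHom f) := by
  refine AddMonoidHomClass.continuous_of_bound (dualPosAddHom f) ‖f‖ fun x => ?_
  have hp : ‖x⁺‖ ≤ ‖x‖ := HasSolidNorm.solid (by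
    rw [abs_of_nonneg (posPart_nonneg x)]; exact sup_le (le_abs_self x) (abs_nonneg x))
  have hn : ‖x⁻‖ ≤ ‖x‖ := HasSolidNorm.solid (by
    rw [abs_of_nonneg (negPart_nonneg x)]; exact sup_le (neg_le_abs x) (abs_nonneg x))
  have h1 := coneSup_nonneg f (posPart_nonneg x)
  have h2 := coneSup_nonneg f (negPart_nonneg x)
  have h3 := (coneSup_le_norm f (posPart_nonneg x)).trans
    (mul_le_mul_of_nonneg_left hp (norm_nonneg f))
  have h4 := (coneSup_le_norm f (negPart_nonneg x)).trans
    (mul_le_mul_of_nonneg_left hn (norm_nonneg f))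
  change |coneSup f x⁺ - coneSup f x⁻| ≤ ‖f‖ * ‖x‖
  rw [abs_le]
  constructor <;> linarith

/-- The positive part of a continuous functional, as a continuous functional. -/
noncomputable def dualPos (f : StrongDual ℝ E) : StrongDual ℝ E :=
  (dualPosAddHom f).toRealLinearMap (continuous_dualPosAddHom f)

theorem dualPos_apply_of_nonneg (f : StrongDual ℝ E) {x : E} (hx : 0 ≤ x) :
    dualPos f x = coneSup f x := by
  change coneSup f x⁺ - coneSup f x⁻ = coneSup f x
  rw [posPart_of_nonneg hx, negPart_of_nonneg hx]
  simp [coneSup]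

theorem coneSup_sub_le {f g h : StrongDual ℝ E} (hf : f ≤ h) (hg : g ≤ h) {x : E} (hx : 0 ≤ x) :
    coneSup (f - g) x ≤ h x - g x := by
  refine coneSup_le (f - g) hx fun y hy hyx => ?_
  have h1 : f y ≤ h y := hf y hy
  have h2 : g (x - y) ≤ h (x - y) := hg (x - y) (sub_nonneg.2 hyx)
  rw [map_sub, map_sub] at h2
  change f y - g y ≤ h x - g x
  linarith

theorem coneSup_sub_le' {f g h : StrongDual ℝ E} (hf : h ≤ f) (hg : h ≤ g) {x : E} (hx : 0 ≤ x) :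
    coneSup (f - g) x ≤ f x - h x := by
  refine coneSup_le (f - g) hx fun y hy hyx => ?_
  have h1 : h y ≤ g y := hg y hy
  have h2 : h (x - y) ≤ f (x - y) := hf (x - y) (sub_nonneg.2 hyx)
  rw [map_sub, map_sub] at h2
  change f y - g y ≤ f x - h x
  linarith

/-- The dual of a normed lattice is a lattice for its canonical order. -/
noncomputable instance instLatticeDual : Lattice (StrongDual ℝ E) where
  sup f g := g + dualPos (f - g)
  inf f g := f - dualPos (f - g)
  le_sup_left f g x hx := by
    have h : f x - g x ≤ coneSup (f - g) x := le_coneSup (f - g) hx le_rfl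
    change f x ≤ g x + dualPos (f - g) x
    rw [dualPos_apply_of_nonneg _ hx]
    linarith
  le_sup_right f g x hx := by
    have h := coneSup_nonneg (f - g) hx
    change g x ≤ g x + dualPos (f - g) x
    rw [dualPos_apply_of_nonneg _ hx]
    linarith
  sup_le f g h hf hg x hx := by
    have hc := coneSup_sub_le hf hg hx
    change g x + dualPos (f - g) x ≤ h x
    rw [dualPos_apply_of_nonneg _ hx]
    linarith
  inf_le_left f g x hx := by
    have h := coneSup_nonneg (f - g) hx
    change f x - dualPos (f - g) x ≤ f x
    rw [dualPos_apply_of_nonneg _ hx]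
    linarith
  inf_le_right f g x hx := by
    have h : f x - g x ≤ coneSup (f - g) x := le_coneSup (f - g) hx le_rfl
    change f x - dualPos (f - g) x ≤ g x
    rw [dualPos_apply_of_nonneg _ hx]
    linarith
  le_inf h f g hf hg x hx := by
    have hc := coneSup_sub_le' hf hg hx
    change h x ≤ f x - dualPos (f - g) x
    rw [dualPos_apply_of_nonneg _ hx]
    linarith

/-- A norm bounded subset `B` of the dual of `E` is an almost L-set if every disjoint weakly null
sequence of `E` converges to zero uniformly on `B`. -/
def IsAlmostLSet (B : Set (StrongDual ℝ E)) : Prop :=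
  Bornology.IsBounded B ∧
    ∀ x : ℕ → E, IsDisjointSeq x → IsWeaklyNull x →
      TendstoUniformlyOn (fun n (f : StrongDual ℝ E) => f (x n)) (fun _ => 0) atTop B

end Dual

end BanachLattice

/-! The tool for both directions is `exists_isDisjointSeq_of_packing`: if finitely many positive
functionals can always be given separate portions of `u` on which they are large, then some disjoint
sequence in `[0, u]` also carries large values.

Suppose `E*` has order continuous norm. Restricting `f ≥ 0` to the elements disjoint from more and
more terms of a bounded disjoint sequence gives decreasing functionals, and order continuity forces
`f` to zero along the sequence. Hence bounded disjoint sequences are weakly null, and `|g n| (x n) →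
0` for positive ones and `g n` in an almost L-set `B`. It follows that some `u ≥ 0` makes `|g| (x -
u)⁺` small uniformly over `g ∈ B` and `x` in the positive unit ball. A disjoint sequence in the
solid hull of `B` with norms at least `ε` would then have mass bounded below at `u`. Disjoint
functionals can be packed, so a disjoint sequence in `[0, u]` would contradict the limit above.

Conversely, singletons are almost L-sets, so disjoint sequences in an order interval `[0, f]` of
`E*` are norm null. Packing in `E*`, with evaluations at points of `E` as the functionals, shows
that a decreasing sequence of positive functionals has arbitrarily small steps. So a directed set
with infimum `0` has elements below which it varies little in norm; as it tends to `0` pointwise on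
the cone, those elements have small norm. -/

namespace BanachLattice

/-! ### Disjointness and packing in vector lattices -/

section VectorLattice

theorem inf_eq_zero_of_le {α : Type*} [Lattice α] [Zero α] {a b a' b' : α} (ha : 0 ≤ a) (hb : 0 ≤ b) (haa : a ≤ a') (hbb : b ≤ b')
    (h : a' ⊓ b' = 0) : a ⊓ b = 0 :=
  le_antisymm (h ▸ inf_le_inf haa hbb) (le_inf ha hb)

variable {F : Type*} [AddCommGroup F] [Lattice F] [IsOrderedAddMonoid F]

theorem inf_add_le_inf_add_inf {a b c : F} (ha : 0 ≤ a) (hb : 0 ≤ b) (hc : 0 ≤ c) :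
    a ⊓ (b + c) ≤ a ⊓ b + a ⊓ c := by
  have h1 : a ⊓ (b + c) ≤ a ⊓ b + c := by
    rw [inf_add]
    exact inf_le_inf_right _ (le_add_of_nonneg_right hc)
  have h2 : a ⊓ (b + c) ≤ a ⊓ b + a :=
    inf_le_left.trans (le_add_of_nonneg_left (le_inf ha hb))
  rw [add_inf]
  exact le_inf h2 h1

theorem inf_add_eq_zero {a b c : F} (ha : 0 ≤ a) (hb : 0 ≤ b) (hc : 0 ≤ c)
    (hab : a ⊓ b = 0) (hac : a ⊓ c = 0) : a ⊓ (b + c) = 0 := by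
  refine le_antisymm ?_ (le_inf ha (add_nonneg hb hc))
  simpa [hab, hac] using inf_add_le_inf_add_inf ha hb hc

theorem inf_sum_eq_zero {ι : Type*} {a : F} {b : ι → F} {J : Finset ι} (ha : 0 ≤ a)
    (hb : ∀ i ∈ J, 0 ≤ b i) (h : ∀ i ∈ J, a ⊓ b i = 0) : a ⊓ ∑ i ∈ J, b i = 0 := by
  classical
  induction J using Finset.induction_on with
  | empty => simpa using ha
  | insert j J hj ih =>
    rw [Finset.sum_insert hj]
    have hb' : ∀ i ∈ J, 0 ≤ b i := fun i hi => hb i (Finset.mem_insert_of_mem hi)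
    exact inf_add_eq_zero ha (hb j (Finset.mem_insert_self j J)) (Finset.sum_nonneg hb')
      (h j (Finset.mem_insert_self j J)) (ih hb' fun i hi => h i (Finset.mem_insert_of_mem hi))

variable [Module ℝ F] [IsOrderedModule ℝ F]

theorem inf_eq_zero_of_inf_smul_eq_zero {a b : F} {s : ℝ} (hs : 0 < s) (ha : 0 ≤ a) (hb : 0 ≤ b)
    (h : a ⊓ s • b = 0) : a ⊓ b = 0 := by
  set r : ℝ := min s 1 with hr
  have hr0 : 0 < r := lt_min hs one_pos
  have hz : 0 ≤ a ⊓ b := le_inf ha hb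
  have h1 : r • (a ⊓ b) ≤ a := by
    have := smul_le_smul_of_nonneg_right (min_le_right s 1) hz
    rw [one_smul] at this
    exact this.trans inf_le_left
  have h2 : r • (a ⊓ b) ≤ s • b :=
    (smul_le_smul_of_nonneg_right (min_le_left s 1) hz).trans
      (smul_le_smul_of_nonneg_left inf_le_right hs.le)
  have h3 : r • (a ⊓ b) ≤ 0 := h ▸ le_inf h1 h2
  have h4 := smul_le_smul_of_nonneg_left h3 (inv_pos.2 hr0).le
  rw [smul_zero, inv_smul_smul₀ hr0.ne'] at h4
  exact le_antisymm h4 hz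

/-- Since `s * t ≥ 1`, `s • (b - t • a)⁺` lies below `(a - s • b)⁻`, which is disjoint from `(a - s
• b)⁺`. -/
theorem posPart_inf_posPart_eq_zero {a b : F} {s t : ℝ} (hs : 0 < s) (ha : 0 ≤ a)
    (hst : 1 ≤ s * t) : (a - s • b)⁺ ⊓ (b - t • a)⁺ = 0 := by
  refine inf_eq_zero_of_inf_smul_eq_zero hs (posPart_nonneg _) (posPart_nonneg _) ?_
  refine inf_eq_zero_of_le (posPart_nonneg _) (smul_nonneg hs.le (posPart_nonneg _)) le_rfl ?_
    (posPart_inf_negPart_eq_zero (a - s • b))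
  have h1 : s⁻¹ • (a - s • b)⁻ ≥ (b - t • a)⁺ := by
    refine sup_le ?_ (smul_nonneg (inv_pos.2 hs).le (negPart_nonneg _))
    have h2 : s • (b - t • a) ≤ (a - s • b)⁻ := by
      refine le_trans ?_ (neg_le_negPart (a - s • b))
      rw [smul_sub, smul_smul, neg_sub]
      refine sub_le_sub_left ?_ _
      simpa using smul_le_smul_of_nonneg_right hst ha
    have h3 := smul_le_smul_of_nonneg_left h2 (inv_pos.2 hs).le
    rwa [inv_smul_smul₀ hs.ne'] at h3
  have h4 := smul_le_smul_of_nonneg_left h1 hs.le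
  rwa [smul_inv_smul₀ hs.ne'] at h4

/-- One step of an exhaustion: a piece `x` with large `f i x` is cut from the remainder `w`, leaving
a disjoint `w'` that infinitely many `f m` hardly distinguish from `u`. -/
theorem packing_step {f : ℕ → F →ₗ[ℝ] ℝ} (hf : ∀ n y, 0 ≤ y → 0 ≤ f n y) {u : F}
    {M ε : ℝ} (hM : ∀ n, f n u ≤ M) (hε : 0 < ε)
    (h : ∀ J : Finset ℕ, ∃ v : ℕ → F, (∀ i ∈ J, 0 ≤ v i) ∧ ∑ i ∈ J, v i ≤ u ∧
      ∀ i ∈ J, ε ≤ f i (v i))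
    {w : F} {I : Set ℕ} (hw : 0 ≤ w) (hwu : w ≤ u) (hI : I.Infinite) {α : ℝ} (hα : α < ε / 4)
    (hfα : ∀ m ∈ I, f m (u - w) ≤ α) :
    ∃ (i : ℕ) (x w' : F) (I' : Set ℕ), 0 ≤ x ∧ x ≤ w ∧ ε / 2 ≤ f i x ∧ 0 ≤ w' ∧ w' ≤ w ∧
      x ⊓ w' = 0 ∧ I'.Infinite ∧ ∃ β < ε / 4, ∀ m ∈ I', f m (u - w') ≤ β := by
  have mono : ∀ n {y z : F}, y ≤ z → f n y ≤ f n z := fun n y z hyz => by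
    have := hf n (z - y) (sub_nonneg.2 hyz)
    rw [map_sub] at this
    linarith
  have hM0 : 0 ≤ M := (hf 0 u (hw.trans hwu)).trans (hM 0)
  -- Then `c * M ≤ ε / 4`, which bounds the cost of replacing `z` by `z - c • w`; `M + 1` guards
  -- against `M = 0`.
  set c : ℝ := ε / (4 * (M + 1)) with hc
  have hc0 : 0 < c := by positivity
  have hcM : c * M ≤ ε / 4 := by
    rw [hc, div_mul_eq_mul_div, div_le_div_iff₀ (by positivity) (by positivity)]
    nlinarith
  -- Half of the room left below `ε / 4`; it is the mass that `w'` may lose.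
  set β : ℝ := (ε / 4 - α) / 2 with hβ
  have hβ0 : 0 < β := by rw [hβ]; linarith
  obtain ⟨N, hN⟩ := exists_nat_gt (M / (c * β))
  have hN0 : (0 : ℝ) < N := lt_of_le_of_lt (by positivity) hN
  rw [div_lt_iff₀ (by positivity)] at hN
  obtain ⟨J, hJI, hJN⟩ := hI.exists_subset_card_eq N
  obtain ⟨v, hv0, hvu, hvε⟩ := h J
  have hv'0 : ∀ i ∈ J, 0 ≤ v i ⊓ w := fun i hi => le_inf (hv0 i hi) hw
  -- The `N` pieces have total mass at most `M < N * (c * β)`, so one is light for `f m`. As `J` is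
  -- finite, one `i` serves infinitely many `m`.
  have pigeon : ∀ m, ∃ i ∈ J, f m (v i ⊓ w) ≤ c * β := by
    intro m
    by_contra! hcon
    have h1 : ∑ i ∈ J, f m (v i ⊓ w) ≤ M := by
      rw [← map_sum]
      exact (mono m ((Finset.sum_le_sum fun i _ => inf_le_left).trans hvu)).trans (hM m)
    have h2 : ∑ _i ∈ J, c * β ≤ ∑ i ∈ J, f m (v i ⊓ w) :=
      Finset.sum_le_sum fun i hi => (hcon i hi).le
    rw [Finset.sum_const, hJN, nsmul_eq_mul] at h2
    linarith
  obtain ⟨i, hiJ, hinf⟩ : ∃ i ∈ J, {m ∈ I | f m (v i ⊓ w) ≤ c * β}.Infinite := by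
    by_contra! hcon
    refine hI ((J.finite_toSet.biUnion hcon).subset fun m hm => ?_)
    obtain ⟨i, hi, him⟩ := pigeon m
    exact Set.mem_biUnion (show i ∈ (J : Set ℕ) from hi) ⟨hm, him⟩
  set z := v i ⊓ w with hz
  have hz0 : 0 ≤ z := hv'0 i hiJ
  have hfz : ε - α ≤ f i z := by
    -- Here `v i - v i ⊓ w = v i ⊔ w - w`.
    have h1 : v i - z ≤ u - w := by
      have : v i ⊔ w ≤ u := sup_le
        ((Finset.single_le_sum (f := v) hv0 hiJ).trans hvu) hwu
      have h2 := inf_add_sup (v i) w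
      rw [hz, sub_le_sub_iff, ← h2, add_comm]
      exact add_le_add_left this _
    have h3 := (mono i h1).trans (hfα i (hJI hiJ))
    rw [map_sub] at h3
    linarith [hvε i hiJ]
  refine ⟨i, (z - c • w)⁺, (w - c⁻¹ • z)⁺, _, posPart_nonneg _, ?_, ?_, posPart_nonneg _, ?_,
    posPart_inf_posPart_eq_zero hc0 hz0 (mul_inv_cancel₀ hc0.ne').ge, hinf, α + β, ?_, ?_⟩
  · exact sup_le ((sub_le_self _ (smul_nonneg hc0.le hw)).trans inf_le_right) hw
  · have h1 := mono i (le_posPart (z - c • w))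
    rw [map_sub, map_smul, smul_eq_mul] at h1
    have h2 : c * f i w ≤ c * M := mul_le_mul_of_nonneg_left ((mono i hwu).trans (hM i)) hc0.le
    linarith
  · exact sup_le (sub_le_self _ (smul_nonneg (inv_pos.2 hc0).le hz0)) hw
  · rw [hβ]; linarith
  · rintro m ⟨hmI, hm⟩
    have h1 := mono m (le_posPart (w - c⁻¹ • z))
    rw [map_sub, map_smul, smul_eq_mul] at h1
    have h2 : c⁻¹ * f m z ≤ β := by
      rw [inv_mul_le_iff₀ hc0]
      exact hm
    have h3 := hfα m hmI
    rw [map_sub] at h3 ⊢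
    linarith

/-- If positive functionals `f i` of bounded mass on `[0, u]` can be finitely packed, i.e. for
finitely many indices there are `v i ≥ 0` with `∑ v i ≤ u` and `f i (v i) ≥ ε`, then there is a
disjoint sequence in `[0, u]` on whose terms some of the `f i` are at least `ε / 2`. -/
theorem exists_isDisjointSeq_of_packing {f : ℕ → F →ₗ[ℝ] ℝ} (hf : ∀ n y, 0 ≤ y → 0 ≤ f n y)
    {u : F} (hu : 0 ≤ u) {M ε : ℝ} (hM : ∀ n, f n u ≤ M) (hε : 0 < ε)
    (h : ∀ J : Finset ℕ, ∃ v : ℕ → F, (∀ i ∈ J, 0 ≤ v i) ∧ ∑ i ∈ J, v i ≤ u ∧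
      ∀ i ∈ J, ε ≤ f i (v i)) :
    ∃ (n : ℕ → ℕ) (x : ℕ → F), IsDisjointSeq x ∧
      ∀ k, 0 ≤ x k ∧ x k ≤ u ∧ ε / 2 ≤ f (n k) (x k) := by
  let S := {p : F × Set ℕ // 0 ≤ p.1 ∧ p.1 ≤ u ∧ p.2.Infinite ∧
    ∃ α < ε / 4, ∀ m ∈ p.2, f m (u - p.1) ≤ α}
  have step : ∀ s : S, ∃ (i : ℕ) (x : F) (s' : S), 0 ≤ x ∧ x ≤ s.1.1 ∧ ε / 2 ≤ f i x ∧
      s'.1.1 ≤ s.1.1 ∧ x ⊓ s'.1.1 = 0 := by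
    rintro ⟨⟨w, I⟩, hw, hwu, hI, α, hα, hfα⟩
    obtain ⟨i, x, w', I', h1, h2, h3, h4, h5, h6, h7, h8⟩ :=
      packing_step hf hM hε h hw hwu hI hα hfα
    exact ⟨i, x, ⟨(w', I'), h4, h5.trans hwu, h7, h8⟩, h1, h2, h3, h5, h6⟩
  choose i x next h0 hle hε' hnext hdisj using step
  let s : ℕ → S := fun k => Nat.rec
    ⟨(u, Set.univ), hu, le_rfl, Set.infinite_univ, 0, by positivity, by simp⟩ (fun _ t => next t) k
  have hs : ∀ k, s (k + 1) = next (s k) := fun _ => rfl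
  have hanti : Antitone fun k => (s k).1.1 := antitone_nat_of_succ_le fun k => hnext (s k)
  -- Each piece is disjoint from the next remainder, which dominates all later pieces.
  have key : ∀ n m, n < m → x (s n) ⊓ x (s m) = 0 := fun n m hnm => by
    refine inf_eq_zero_of_le (h0 _) (h0 _) le_rfl ?_ (hdisj (s n))
    exact (hle (s m)).trans (hanti hnm)
  refine ⟨fun k => i (s k), fun k => x (s k), fun n m hnm => ?_, fun k =>
    ⟨h0 _, (hle _).trans (s k).2.2.1, hε' _⟩⟩
  simp only [abs_of_nonneg (h0 _)]
  rcases hnm.lt_or_gt with hlt | hlt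
  · exact key n m hlt
  · rw [inf_comm]
    exact key m n hlt

end VectorLattice

theorem isWeaklyNull_iff {X : Type*} [NormedAddCommGroup X] [NormedSpace ℝ X] {x : ℕ → X} :
    IsWeaklyNull x ↔ ∀ f : StrongDual ℝ X, Tendsto (fun n => f (x n)) atTop (𝓝 0) := by
  have hinj : Function.Injective (topDualPairing ℝ X).flip :=
    (injective_iff_map_eq_zero _).2 fun y hy =>
      SeparatingDual.eq_zero_of_forall_dual_eq_zero (R := ℝ) fun f => LinearMap.congr_fun hy f
  have h := WeakBilin.tendsto_iff_forall_eval_tendsto (l := atTop)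
    (f := fun n => toWeakSpace ℝ X (x n)) (x := 0) _ hinj
  refine h.trans (forall_congr' fun f => ?_)
  change Tendsto (fun n => f (x n)) atTop (𝓝 (f 0)) ↔ _
  rw [map_zero]

/-! ### Modulus and directed infima in the dual -/

section DualLattice

variable {E : Type*} [NormedAddCommGroup E] [NormedSpace ℝ E] [Lattice E]
  [IsOrderedAddMonoid E]

theorem dual_mono {f : StrongDual ℝ E} (hf : 0 ≤ f) {x y : E} (h : x ≤ y) : f x ≤ f y := by
  have h1 : 0 ≤ f (y - x) := hf (y - x) (sub_nonneg.2 h)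
  rw [map_sub] at h1
  linarith

theorem dual_apply_nonneg {f : StrongDual ℝ E} (hf : 0 ≤ f) {x : E} (hx : 0 ≤ x) : 0 ≤ f x :=
  hf x hx

variable [HasSolidNorm E]

instance instIsOrderedAddMonoidDual : IsOrderedAddMonoid (StrongDual ℝ E) where
  add_le_add_left f g h k x hx := by
    have h1 : f x ≤ g x := h x hx
    change f x + k x ≤ g x + k x
    linarith

instance instIsOrderedModuleDual : IsOrderedModule ℝ (StrongDual ℝ E) where
  smul_le_smul_of_nonneg_left _ hc _ _ h x hx :=
    mul_le_mul_of_nonneg_left (h x hx) hc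
  smul_le_smul_of_nonneg_right _ hf _ _ hcd x hx :=
    mul_le_mul_of_nonneg_right hcd (hf x hx)

theorem apply_le_abs_apply (f : StrongDual ℝ E) {x z : E} (hz : |z| ≤ x) : f z ≤ |f| x := by
  have h1 : f z⁺ ≤ |f| z⁺ := le_abs_self f z⁺ (posPart_nonneg z)
  have h2 : -f z⁻ ≤ |f| z⁻ := neg_le_abs f z⁻ (negPart_nonneg z)
  have h3 : |f| (z⁺ + z⁻) ≤ |f| x := dual_mono (abs_nonneg f) (by rwa [posPart_add_negPart])
  rw [map_add] at h3
  have h4 : f z = f z⁺ - f z⁻ := by rw [← map_sub, posPart_sub_negPart]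
  linarith

theorem abs_apply_le_abs_apply_abs (f : StrongDual ℝ E) (z : E) : |f z| ≤ |f| |z| := by
  refine abs_le'.2 ⟨apply_le_abs_apply f le_rfl, ?_⟩
  rw [← map_neg]
  exact apply_le_abs_apply f (abs_neg z).le

theorem dual_sup_apply (f g : StrongDual ℝ E) {x : E} (hx : 0 ≤ x) :
    (f ⊔ g) x = g x + coneSup (f - g) x := by
  rw [← dualPos_apply_of_nonneg _ hx]
  rfl

theorem dual_inf_apply (f g : StrongDual ℝ E) {x : E} (hx : 0 ≤ x) :
    (f ⊓ g) x = f x - coneSup (f - g) x := by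
  rw [← dualPos_apply_of_nonneg _ hx]
  rfl

theorem abs_dual_apply_le (f : StrongDual ℝ E) {x : E} (hx : 0 ≤ x) {c : ℝ}
    (h : ∀ z, |z| ≤ x → f z ≤ c) : |f| x ≤ c := by
  change (f ⊔ -f) x ≤ c
  rw [dual_sup_apply _ _ hx]
  have h1 : coneSup (f - -f) x ≤ c + f x := by
    refine coneSup_le _ hx fun y hy hyx => ?_
    -- With `z = 2y - x` one has `|z| ≤ x` and `2 f y = f z + f x`.
    have h2 := h (y - (x - y)) (abs_le'.2 ⟨(sub_le_self _ (sub_nonneg.2 hyx)).trans hyx, by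
      rw [neg_sub]; exact (sub_le_self _ hy).trans (sub_le_self _ hy)⟩)
    rw [map_sub, map_sub] at h2
    change f y - (-f y) ≤ c + f x
    linarith
  change -f x + _ ≤ c
  linarith

theorem abs_dual_apply_le_norm (f : StrongDual ℝ E) {x : E} (hx : 0 ≤ x) :
    |f| x ≤ ‖f‖ * ‖x‖ := by
  refine abs_dual_apply_le f hx fun z hz => (le_abs_self _).trans ((f.le_opNorm z).trans ?_)
  refine mul_le_mul_of_nonneg_left (HasSolidNorm.solid ?_) (norm_nonneg f)
  rwa [abs_of_nonneg hx]

theorem norm_dual_le_of_forall_nonneg (f : StrongDual ℝ E) {c : ℝ} (hc : 0 ≤ c)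
    (h : ∀ x, 0 ≤ x → |f| x ≤ c * ‖x‖) : ‖f‖ ≤ c := by
  refine f.opNorm_le_bound hc fun x => ?_
  have h1 := (abs_apply_le_abs_apply_abs f x).trans (h |x| (abs_nonneg x))
  rwa [norm_abs_eq_norm] at h1

theorem exists_nonneg_apply_gt [IsOrderedModule ℝ E] (f : StrongDual ℝ E) {c : ℝ} (hc : 0 ≤ c) (h : c < ‖f‖) :
    ∃ x, 0 ≤ x ∧ ‖x‖ ≤ 1 ∧ c < |f| x := by
  by_contra! hcon
  refine h.not_ge (norm_dual_le_of_forall_nonneg f hc fun x hx => ?_)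
  rcases hx.eq_or_lt with rfl | hx'
  · simp
  have hn : 0 < ‖x‖ := norm_pos_iff.2 hx'.ne'
  have h1 := hcon (‖x‖⁻¹ • x) (smul_nonneg (inv_nonneg.2 hn.le) hx)
    (by rw [norm_smul, norm_inv, norm_norm, inv_mul_cancel₀ hn.ne'])
  rwa [map_smul, smul_eq_mul, inv_mul_le_iff₀ hn, mul_comm] at h1

/-- A functional that is additive and bounded on the positive cone extends to a continuous
linear functional. -/
theorem exists_dual_of_cone {φ : E → ℝ}
    (hadd : ∀ x y, 0 ≤ x → 0 ≤ y → φ (x + y) = φ x + φ y) {C : ℝ}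
    (hC : ∀ x, 0 ≤ x → |φ x| ≤ C * ‖x‖) : ∃ g : StrongDual ℝ E, ∀ x, 0 ≤ x → g x = φ x := by
  let A : E →+ ℝ := AddMonoidHom.mk' (fun x => φ x⁺ - φ x⁻) fun x y => by
    have key : (x + y)⁺ + (x⁻ + y⁻) = (x + y)⁻ + (x⁺ + y⁺) := by
      have h1 := posPart_sub_negPart (x + y)
      have h4 : (x + y)⁺ - (x + y)⁻ = (x⁺ - x⁻) + (y⁺ - y⁻) := by
        rw [h1, posPart_sub_negPart, posPart_sub_negPart]
      rw [sub_eq_iff_eq_add] at h4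
      rw [h4]
      abel
    have h := congrArg φ key
    rw [hadd _ _ (posPart_nonneg _) (add_nonneg (negPart_nonneg _) (negPart_nonneg _)),
      hadd _ _ (negPart_nonneg _) (negPart_nonneg _),
      hadd _ _ (negPart_nonneg _) (add_nonneg (posPart_nonneg _) (posPart_nonneg _)),
      hadd _ _ (posPart_nonneg _) (posPart_nonneg _)] at h
    linarith
  have hA : Continuous A := by
    refine AddMonoidHomClass.continuous_of_bound A (|C| + |C|) fun x => ?_
    have hp : ‖x⁺‖ ≤ ‖x‖ := HasSolidNorm.solid (by
      rw [abs_of_nonneg (posPart_nonneg x)]; exact sup_le (le_abs_self x) (abs_nonneg x))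
    have hn : ‖x⁻‖ ≤ ‖x‖ := HasSolidNorm.solid (by
      rw [abs_of_nonneg (negPart_nonneg x)]; exact sup_le (neg_le_abs x) (abs_nonneg x))
    have h1 := (hC _ (posPart_nonneg x)).trans (mul_le_mul (le_abs_self C) hp (norm_nonneg _)
      (abs_nonneg C))
    have h2 := (hC _ (negPart_nonneg x)).trans (mul_le_mul (le_abs_self C) hn (norm_nonneg _)
      (abs_nonneg C))
    change |φ x⁺ - φ x⁻| ≤ _
    rw [add_mul]
    exact (abs_sub _ _).trans (add_le_add h1 h2)
  refine ⟨A.toRealLinearMap hA, fun x hx => ?_⟩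
  have h0 : φ 0 = 0 := by simpa using hadd 0 0 le_rfl le_rfl
  change φ x⁺ - φ x⁻ = φ x
  rw [posPart_of_nonneg hx, negPart_of_nonneg hx, h0, sub_zero]

/-- A downward directed set of positive functionals has an infimum, computed pointwise on the
positive cone. -/
theorem exists_isGLB_dual {D : Set (StrongDual ℝ E)} (hne : D.Nonempty)
    (hdir : DirectedOn (fun a b => b ≤ a) D) (hpos : ∀ g ∈ D, 0 ≤ g) :
    ∃ h : StrongDual ℝ E, 0 ≤ h ∧ (∀ g ∈ D, h ≤ g) ∧
      ∀ x, 0 ≤ x → ∀ η > 0, ∃ g ∈ D, g x < h x + η := by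
  let φ : E → ℝ := fun x => sInf ((fun g : StrongDual ℝ E => g x) '' D)
  have hbdd : ∀ x, 0 ≤ x → BddBelow ((fun g : StrongDual ℝ E => g x) '' D) := fun x hx =>
    ⟨0, by rintro _ ⟨g, hg, rfl⟩; exact hpos g hg x hx⟩
  have hle : ∀ x, 0 ≤ x → ∀ g ∈ D, φ x ≤ g x := fun x hx g hg =>
    csInf_le (hbdd x hx) ⟨g, hg, rfl⟩
  have hlt : ∀ x, ∀ η > 0, ∃ g ∈ D, g x < φ x + η := fun x η hη => by
    obtain ⟨_, ⟨g, hg, rfl⟩, h⟩ := exists_lt_of_csInf_lt (hne.image fun g => g x)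
      (lt_add_of_pos_right (φ x) hη)
    exact ⟨g, hg, h⟩
  have hφ0 : ∀ x, 0 ≤ x → 0 ≤ φ x := fun x hx =>
    le_csInf (hne.image _) (by rintro _ ⟨g, hg, rfl⟩; exact hpos g hg x hx)
  obtain ⟨g₀, hg₀⟩ := hne
  obtain ⟨h, hh⟩ := exists_dual_of_cone (φ := φ) (C := ‖g₀‖) (fun x y hx hy => by
    apply le_antisymm
    · refine le_of_forall_pos_lt_add fun η hη => ?_
      obtain ⟨g, hg, h1⟩ := hlt x (η / 2) (half_pos hη)
      obtain ⟨k, hk, h2⟩ := hlt y (η / 2) (half_pos hη)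
      -- Directedness supplies one `l` nearly minimal at both `x` and `y`, which makes the infimum
      -- additive.
      obtain ⟨l, hl, hlg, hlk⟩ := hdir g hg k hk
      have h3 := hle (x + y) (add_nonneg hx hy) l hl
      have h4 : l x ≤ g x := hlg x hx
      have h5 : l y ≤ k y := hlk y hy
      rw [map_add] at h3
      linarith
    · refine le_of_forall_pos_lt_add fun η hη => ?_
      obtain ⟨g, hg, h1⟩ := hlt (x + y) η hη
      rw [map_add] at h1
      linarith [hle x hx g hg, hle y hy g hg]) (fun x hx => by
    rw [abs_of_nonneg (hφ0 x hx)]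
    exact (hle x hx g₀ hg₀).trans ((le_abs_self _).trans (g₀.le_opNorm x)))
  refine ⟨h, fun x hx => ?_, fun g hg x hx => ?_, fun x hx η hη => ?_⟩
  · change 0 ≤ h x
    exact hh x hx ▸ hφ0 x hx
  · exact hh x hx ▸ hle x hx g hg
  · exact hh x hx ▸ hlt x η hη

end DualLattice

/-! ### Bounded disjoint sequences under an order continuous dual norm -/

section WeaklyNull

variable {E : Type*} [NormedAddCommGroup E] [NormedSpace ℝ E] [Lattice E] [HasSolidNorm E]
  [IsOrderedAddMonoid E]

/-- The restriction of a positive functional to an ideal `I`: its value at `y ≥ 0` is the supremum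
of `f` on `[0, y] ∩ I`. -/
theorem exists_dual_restrict {f : StrongDual ℝ E} (hf : 0 ≤ f) {I : Set E} (h0 : (0 : E) ∈ I)
    (hadd : ∀ x y, 0 ≤ x → 0 ≤ y → x ∈ I → y ∈ I → x + y ∈ I)
    (hdown : ∀ x y, 0 ≤ x → x ≤ y → y ∈ I → x ∈ I) :
    ∃ h : StrongDual ℝ E, (∀ y z, 0 ≤ z → z ≤ y → z ∈ I → f z ≤ h y) ∧
      ∀ y c, 0 ≤ y → (∀ z, 0 ≤ z → z ≤ y → z ∈ I → f z ≤ c) → h y ≤ c := by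
  let φ : E → ℝ := fun y => sSup (f '' {z | 0 ≤ z ∧ z ≤ y ∧ z ∈ I})
  have hbdd : ∀ y, BddAbove (f '' {z | 0 ≤ z ∧ z ≤ y ∧ z ∈ I}) := fun y =>
    ⟨f y, by rintro _ ⟨z, hz, rfl⟩; exact dual_mono hf hz.2.1⟩
  have le_φ : ∀ y z, 0 ≤ z → z ≤ y → z ∈ I → f z ≤ φ y := fun y z h1 h2 h3 =>
    le_csSup (hbdd y) ⟨z, ⟨h1, h2, h3⟩, rfl⟩
  have φ_le : ∀ y c, 0 ≤ y → (∀ z, 0 ≤ z → z ≤ y → z ∈ I → f z ≤ c) → φ y ≤ c :=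
    fun y c hy h => csSup_le ⟨f 0, 0, ⟨le_rfl, hy, h0⟩, rfl⟩ (by
      rintro _ ⟨z, hz, rfl⟩; exact h z hz.1 hz.2.1 hz.2.2)
  obtain ⟨h, hh⟩ := exists_dual_of_cone (φ := φ) (C := ‖f‖) (fun x y hx hy => by
    apply le_antisymm
    · refine φ_le _ _ (add_nonneg hx hy) fun z hz hzxy hzI => ?_
      have h1 : f (z ⊓ x) ≤ φ x := le_φ _ _ (le_inf hz hx) inf_le_right
        (hdown _ z (le_inf hz hx) inf_le_left hzI)
      have h2 : f (z - z ⊓ x) ≤ φ y := by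
        have h3 : 0 ≤ z - z ⊓ x := sub_nonneg.2 inf_le_left
        refine le_φ _ _ h3 (sub_le_comm.1 (le_inf ?_ ?_))
          (hdown _ z h3 (sub_le_self _ (le_inf hz hx)) hzI)
        · exact sub_le_self z hy
        · exact sub_le_iff_le_add.2 hzxy
      rw [map_sub] at h2
      linarith
    · rw [← le_sub_iff_add_le]
      refine φ_le _ _ hx fun u hu hux huI => ?_
      rw [le_sub_comm]
      refine φ_le _ _ hy fun v hv hvy hvI => ?_
      have h := le_φ _ _ (add_nonneg hu hv) (add_le_add hux hvy) (hadd u v hu hv huI hvI)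
      rw [map_add] at h
      linarith) (fun x hx => by
    rw [abs_of_nonneg (by simpa using le_φ x 0 le_rfl hx h0)]
    exact φ_le x _ hx fun z hz hzx _ => le_norm_of_mem_Icc f ⟨hz, hzx⟩)
  refine ⟨h, fun y z h1 h2 h3 => ?_, fun y c hy hc => ?_⟩
  · exact hh y (h1.trans h2) ▸ le_φ y z h1 h2 h3
  · exact hh y hy ▸ φ_le y c hy hc

/-- If the norm of the dual is order continuous, then positive functionals tend to zero along
norm bounded disjoint sequences. -/
theorem tendsto_apply_of_isDisjointSeq (hE : HasOrderContinuousNorm (StrongDual ℝ E))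
    {f : StrongDual ℝ E} (hf : 0 ≤ f) {x : ℕ → E} (hx : ∀ n, 0 ≤ x n)
    (hd : ∀ n m, n ≠ m → x n ⊓ x m = 0) {C : ℝ} (hC : ∀ n, ‖x n‖ ≤ C) :
    Tendsto (fun n => f (x n)) atTop (𝓝 0) := by
  -- `h n` restricts `f` to the ideal disjoint from `x i` for `i < n`; this ideal contains `x m` for
  -- `m ≥ n`.
  have hr : ∀ n : ℕ, ∃ h : StrongDual ℝ E,
      (∀ y z, 0 ≤ z → z ≤ y → (∀ i < n, x i ⊓ z = 0) → f z ≤ h y) ∧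
      ∀ y c, 0 ≤ y → (∀ z, 0 ≤ z → z ≤ y → (∀ i < n, x i ⊓ z = 0) → f z ≤ c) → h y ≤ c :=
    fun n => exists_dual_restrict hf (I := {z | ∀ i < n, x i ⊓ z = 0})
      (fun i _ => inf_eq_right.2 (hx i))
      (fun y z hy hz hyI hzI i hi => inf_add_eq_zero (hx i) hy hz (hyI i hi) (hzI i hi))
      (fun y z hy hyz hzI i hi => inf_eq_zero_of_le (hx i) hy le_rfl hyz (hzI i hi))
  choose h le_h h_le using hr
  have hpos : ∀ n, 0 ≤ h n := fun n y hy => by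
    simpa using le_h n y 0 le_rfl hy fun i _ => inf_eq_right.2 (hx i)
  have hanti : Antitone h := fun n m hnm y hy =>
    h_le m y _ hy fun z hz hzy hzI => le_h n y z hz hzy fun i hi => hzI i (hi.trans_le hnm)
  obtain ⟨H, hH0, hH, hlt⟩ := exists_isGLB_dual (D := Set.range h) (Set.range_nonempty h)
    (by
      rintro _ ⟨n, rfl⟩ _ ⟨m, rfl⟩
      exact ⟨_, ⟨max n m, rfl⟩, hanti (le_max_left n m), hanti (le_max_right n m)⟩)
    (by rintro _ ⟨n, rfl⟩; exact hpos n)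
  have hglb := hE (Set.range fun n => h n - H) (Set.range_nonempty _)
    (by
      rintro _ ⟨n, rfl⟩ _ ⟨m, rfl⟩
      exact ⟨_, ⟨max n m, rfl⟩, sub_le_sub_right (hanti (le_max_left n m)) H,
        sub_le_sub_right (hanti (le_max_right n m)) H⟩)
    ⟨by rintro _ ⟨n, rfl⟩; exact sub_nonneg.2 (hH _ ⟨n, rfl⟩), fun g hg y hy => by
      change g y ≤ 0
      refine le_of_forall_pos_lt_add fun η hη => ?_
      obtain ⟨_, ⟨n, rfl⟩, hn⟩ := hlt y hy η hη
      have h1 : g y ≤ h n y - H y := hg ⟨n, rfl⟩ y hy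
      linarith⟩
  -- An element of `[0, x m]` disjoint from `x m` is zero, so already `h (m + 1)` is at most `0` at
  -- `x m`.
  have hHx : ∀ m, H (x m) ≤ 0 := fun m => by
    refine le_trans (hH _ ⟨m + 1, rfl⟩ (x m) (hx m)) (h_le (m + 1) _ _ (hx m) ?_)
    intro z _ hzx hzI
    have h1 := hzI m m.lt_succ_self
    rw [inf_eq_right.2 hzx] at h1
    rw [h1, map_zero]
  have hC0 : 0 ≤ C := (norm_nonneg _).trans (hC 0)
  rw [Metric.tendsto_atTop]
  intro ε hε
  have hη : 0 < ε / (C + 1) := by positivity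
  obtain ⟨_, ⟨_, ⟨n, rfl⟩, rfl⟩, -, hn⟩ := hglb.exists_between hη
  refine ⟨n, fun m hm => ?_⟩
  rw [Real.dist_0_eq_abs, abs_of_nonneg (dual_apply_nonneg hf (hx m))]
  have h1 : f (x m) ≤ h n (x m) := le_h n _ _ (hx m) le_rfl fun i hi =>
    hd i m (hi.trans_le hm).ne
  have h2 : (h n - H) (x m) ≤ ‖h n - H‖ * ‖x m‖ :=
    (le_abs_self _).trans ((h n - H).le_opNorm (x m))
  have h3 : ‖h n - H‖ * ‖x m‖ ≤ ε / (C + 1) * C :=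
    mul_le_mul hn.le (hC m) (norm_nonneg _) hη.le
  have h4 : ε / (C + 1) * C < ε := by
    rw [div_mul_eq_mul_div, div_lt_iff₀ (by positivity)]
    nlinarith
  have h5 : (h n - H) (x m) = h n (x m) - H (x m) := rfl
  linarith [hHx m]

theorem isWeaklyNull_of_isDisjointSeq (hE : HasOrderContinuousNorm (StrongDual ℝ E))
    {x : ℕ → E} (hd : IsDisjointSeq x) {C : ℝ} (hC : ∀ n, ‖x n‖ ≤ C) : IsWeaklyNull x := by
  refine isWeaklyNull_iff.2 fun f => ?_
  refine squeeze_zero_norm (fun n => abs_apply_le_abs_apply_abs f (x n)) ?_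
  exact tendsto_apply_of_isDisjointSeq hE (abs_nonneg f) (fun n => abs_nonneg (x n)) hd
    (fun n => (norm_abs_eq_norm (x n)).trans_le (hC n))

theorem IsAlmostLSet.tendsto_abs_apply (hE : HasOrderContinuousNorm (StrongDual ℝ E))
    {B : Set (StrongDual ℝ E)} (hB : IsAlmostLSet B) {x : ℕ → E} (hx : ∀ n, 0 ≤ x n)
    (hd : IsDisjointSeq x) {C : ℝ} (hC : ∀ n, ‖x n‖ ≤ C) {g : ℕ → StrongDual ℝ E}
    (hg : ∀ n, g n ∈ B) : Tendsto (fun n => |g n| (x n)) atTop (𝓝 0) := by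
  -- Near-maximisers of `g n` on `[-x n, x n]` inherit disjointness and the norm bound, so they are
  -- weakly null and the almost L-set property applies to them.
  have hy : ∀ n : ℕ, ∃ y, |y| ≤ x n ∧ |g n| (x n) < g n y + 1 / ((n : ℝ) + 1) := fun n => by
    by_contra! hcon
    have h1 : |g n| (x n) ≤ |g n| (x n) - 1 / ((n : ℝ) + 1) :=
      abs_dual_apply_le _ (hx n) fun z hz => by linarith [hcon z hz]
    have h2 : 0 < 1 / ((n : ℝ) + 1) := by positivity
    linarith
  choose y hyx hgy using hy
  have hyd : IsDisjointSeq y := fun n m hnm => by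
    refine inf_eq_zero_of_le (abs_nonneg _) (abs_nonneg _) ?_ ?_ (hd n m hnm)
    · exact (hyx n).trans (le_abs_self _)
    · exact (hyx m).trans (le_abs_self _)
  have hyw := isWeaklyNull_of_isDisjointSeq hE hyd fun n =>
    (HasSolidNorm.solid (by rw [abs_of_nonneg (hx n)]; exact hyx n)).trans (hC n)
  have hunif := Metric.tendstoUniformlyOn_iff.1 (hB.2 y hyd hyw)
  have hgy0 : Tendsto (fun n => g n (y n)) atTop (𝓝 0) := by
    refine Metric.tendsto_nhds.2 fun ε hε => ?_
    filter_upwards [hunif ε hε] with n hn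
    rw [dist_comm]
    exact hn (g n) (hg n)
  refine squeeze_zero (fun n => dual_apply_nonneg (abs_nonneg _) (hx n)) (fun n => (hgy n).le) ?_
  simpa using hgy0.add tendsto_one_div_add_atTop_nhds_zero_nat

end WeaklyNull

/-! ### Almost L-sets are L-weakly compact -/

section LWeaklyCompact

variable {E : Type*} [NormedAddCommGroup E] [NormedSpace ℝ E] [Lattice E] [HasSolidNorm E]
  [IsOrderedAddMonoid E]

/-- Finitely many pairwise disjoint positive functionals can be packed into any `u ≥ 0`. -/
theorem exists_packing_of_disjoint {f : ℕ → StrongDual ℝ E} (hf : ∀ n, 0 ≤ f n)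
    (hd : ∀ n m, n ≠ m → f n ⊓ f m = 0) (J : Finset ℕ) :
    ∀ u : E, 0 ≤ u → ∀ η > 0, ∃ v : ℕ → E, (∀ i ∈ J, 0 ≤ v i) ∧ ∑ i ∈ J, v i ≤ u ∧
      ∀ i ∈ J, f i u - f i (v i) ≤ η := by
  induction J using Finset.induction_on with
  | empty => exact fun u hu η hη => ⟨0, by simp, by simpa using hu, by simp⟩
  | insert j J hj ih =>
    intro u hu η hη
    have hdisj : f j ⊓ ∑ i ∈ J, f i = 0 := inf_sum_eq_zero (hf j) (fun i _ => hf i)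
      fun i hi => hd j i (fun h => hj (h ▸ hi))
    -- Disjointness gives `y ∈ [0, u]` with nearly all the mass of `f j` and almost none of the
    -- others. Index `j` receives `y`; the others are packed into `u - y`.
    have hcs : f j u - η / 2 < coneSup (f j - ∑ i ∈ J, f i) u := by
      have h1 := dual_inf_apply (f j) (∑ i ∈ J, f i) hu
      rw [hdisj] at h1
      change 0 = _ at h1
      linarith
    obtain ⟨_, ⟨y, ⟨hy0, hyu⟩, rfl⟩, hy⟩ := exists_lt_of_lt_csSup
      ((Set.nonempty_Icc.2 hu).image _) hcs
    replace hy : f j u - η / 2 < f j y - (∑ i ∈ J, f i) y := hy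
    have hsum : (∑ i ∈ J, f i) y = ∑ i ∈ J, f i y := by simp
    have hfy : ∀ i ∈ J, f i y ≤ ∑ i ∈ J, f i y := fun i hi =>
      Finset.single_le_sum (f := fun i => f i y) (fun i _ => dual_apply_nonneg (hf i) hy0) hi
    have hsum0 : 0 ≤ ∑ i ∈ J, f i y :=
      Finset.sum_nonneg fun i _ => dual_apply_nonneg (hf i) hy0
    have hjy := dual_mono (hf j) hyu
    obtain ⟨v, hv0, hvu, hv⟩ := ih (u - y) (sub_nonneg.2 hyu) (η / 2) (half_pos hη)
    have hne : ∀ i ∈ J, i ≠ j := fun i hi h => hj (h ▸ hi)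
    refine ⟨Function.update v j y, ?_, ?_, ?_⟩
    · refine Finset.forall_mem_insert _ _ _ |>.2 ⟨by simpa using hy0, fun i hi => ?_⟩
      rw [Function.update_of_ne (hne i hi)]
      exact hv0 i hi
    · rw [Finset.sum_insert hj, Finset.sum_update_of_notMem hj, Function.update_self]
      exact le_sub_iff_add_le'.1 hvu
    · refine Finset.forall_mem_insert _ _ _ |>.2 ⟨?_, fun i hi => ?_⟩
      · rw [Function.update_self]
        linarith
      · rw [Function.update_of_ne (hne i hi)]
        have h1 := hv i hi
        rw [map_sub] at h1
        linarith [hfy i hi]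

variable [IsOrderedModule ℝ E]

theorem exists_isDisjointSeq_of_disjoint_functionals {f : ℕ → StrongDual ℝ E}
    (hf : ∀ n, 0 ≤ f n) (hd : ∀ n m, n ≠ m → f n ⊓ f m = 0) {u : E} (hu : 0 ≤ u) {M δ : ℝ}
    (hM : ∀ n, f n u ≤ M) (hδ : 0 < δ) (hfu : ∀ n, δ ≤ f n u) :
    ∃ (n : ℕ → ℕ) (x : ℕ → E), IsDisjointSeq x ∧
      ∀ k, 0 ≤ x k ∧ x k ≤ u ∧ δ / 4 ≤ f (n k) (x k) := by
  have h := exists_isDisjointSeq_of_packing (f := fun n => (f n : E →ₗ[ℝ] ℝ))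
    (fun n y hy => hf n y hy) hu hM (half_pos hδ) fun J => by
      obtain ⟨v, h1, h2, h3⟩ := exists_packing_of_disjoint hf hd J u hu (δ / 2) (half_pos hδ)
      refine ⟨v, h1, h2, fun i hi => ?_⟩
      have := h3 i hi
      change δ / 2 ≤ f i (v i)
      linarith [hfu i]
  obtain ⟨n, x, hx, h⟩ := h
  refine ⟨n, x, hx, fun k => ⟨(h k).1, (h k).2.1, ?_⟩⟩
  have := (h k).2.2
  change δ / 2 / 2 ≤ f (n k) (x k) at this
  linarith

variable [CompleteSpace E]

/-- If `|g|` is small along bounded disjoint sequences uniformly in `g ∈ B`, then the positive part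
of the unit ball is contained in an order interval up to an error on which `|g|` is small,
uniformly in `g ∈ B`. -/
theorem exists_forall_abs_apply_posPart_sub_le {B : Set (StrongDual ℝ E)}
    (hbdd : Bornology.IsBounded B)
    (hB : ∀ x : ℕ → E, (∀ n, 0 ≤ x n) → IsDisjointSeq x → (∀ n, ‖x n‖ ≤ 1) →
      ∀ g : ℕ → StrongDual ℝ E, (∀ n, g n ∈ B) → Tendsto (fun n => |g n| (x n)) atTop (𝓝 0))
    {η : ℝ} (hη : 0 < η) :
    ∃ u : E, 0 ≤ u ∧ ∀ x, 0 ≤ x → ‖x‖ ≤ 1 → ∀ g ∈ B, |g| (x - u)⁺ ≤ η := by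
  by_contra! hcon
  choose! X hX0 hX1 G hGB hG using hcon
  -- Each `x n` is a counterexample to the bound at `4 ^ n` times the sum of its predecessors.
  let s : ℕ → E := fun n => Nat.rec 0 (fun n t => t + X ((4 : ℝ) ^ n • t)) n
  let x : ℕ → E := fun n => X ((4 : ℝ) ^ n • s n)
  have hs_succ : ∀ n, s (n + 1) = s n + x n := fun _ => rfl
  have hs0 : ∀ n, 0 ≤ s n := fun n => by
    induction n with
    | zero => exact le_rfl
    | succ n ih => exact add_nonneg ih (hX0 _ (smul_nonneg (by positivity) ih))
  have h4s : ∀ n, 0 ≤ (4 : ℝ) ^ n • s n := fun n => smul_nonneg (by positivity) (hs0 n)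
  have hx0 : ∀ n, 0 ≤ x n := fun n => hX0 _ (h4s n)
  have hx1 : ∀ n, ‖x n‖ ≤ 1 := fun n => hX1 _ (h4s n)
  have hsmono : Monotone s := monotone_nat_of_le_succ fun n => by
    rw [hs_succ]
    exact le_add_of_nonneg_right (hx0 n)
  have hxs : ∀ n m, n < m → x n ≤ s m := fun n m hnm =>
    (le_add_of_nonneg_left (hs0 n)).trans ((hs_succ n).ge.trans (hsmono hnm))
  have hhalf0 : ∀ n, 0 ≤ (1 / 2 : ℝ) ^ n • x n := fun n => smul_nonneg (by positivity) (hx0 n)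
  have hsum : Summable fun n => (1 / 2 : ℝ) ^ n • x n := by
    refine Summable.of_norm_bounded summable_geometric_two fun n => ?_
    rw [norm_smul, norm_pow, Real.norm_of_nonneg (by norm_num : (0 : ℝ) ≤ 1 / 2)]
    exact mul_le_of_le_one_right (by positivity) (hx1 n)
  set T := ∑' n, (1 / 2 : ℝ) ^ n • x n with hT
  have hxT : ∀ n, (1 / 2 : ℝ) ^ n • x n ≤ T := fun n => hsum.le_tsum n fun m _ => hhalf0 m
  have hT0 : 0 ≤ T := (hhalf0 0).trans (hxT 0)
  -- Subtracting `4 ^ n • s n` gives disjointness from earlier terms, and subtracting `(1 / 2) ^ n •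
  -- T` from later ones. The second subtraction costs only `(1 / 2) ^ n * (C * ‖T‖)` under `|g n|`.
  let v : ℕ → E := fun n => (x n - (4 : ℝ) ^ n • s n - (1 / 2 : ℝ) ^ n • T)⁺
  have hv0 : ∀ n, 0 ≤ v n := fun n => posPart_nonneg _
  have hvx : ∀ n, v n ≤ x n := fun n => sup_le
    ((sub_le_self _ (smul_nonneg (by positivity) hT0)).trans (sub_le_self _ (h4s n))) (hx0 n)
  have hvlt : ∀ n m, n < m → v n ⊓ v m = 0 := fun n m hnm => by
    refine inf_eq_zero_of_le (hv0 n) (hv0 m)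
      (a' := (x n - ((1 / 2 : ℝ) ^ n * (1 / 2) ^ m) • x m)⁺) (b' := (x m - (4 : ℝ) ^ m • x n)⁺)
      (posPart_mono ?_) (posPart_mono ?_)
      (posPart_inf_posPart_eq_zero (by positivity) (hx0 n) ?_)
    · refine sub_le_sub (sub_le_self _ (h4s n)) ?_
      rw [mul_smul]
      exact smul_le_smul_of_nonneg_left (hxT m) (by positivity)
    · exact (sub_le_self _ (smul_nonneg (by positivity) hT0)).trans
        (sub_le_sub_left (smul_le_smul_of_nonneg_left (hxs n m hnm) (by positivity)) _)
    -- The product of the two coefficients is `2 ^ (m - n) ≥ 1`.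
    · have h1 : (4 : ℝ) ^ m = 2 ^ m * 2 ^ m := by rw [← mul_pow]; norm_num
      have h2 : (1 / 2 : ℝ) ^ n * (1 / 2) ^ m * 4 ^ m = (1 / 2) ^ n * 2 ^ m := by
        rw [h1, mul_assoc, ← mul_assoc ((1 / 2 : ℝ) ^ m), ← mul_pow]
        norm_num
      have h3 : (1 : ℝ) = (1 / 2) ^ n * 2 ^ n := by rw [← mul_pow]; norm_num
      rw [h2]
      calc (1 : ℝ) = (1 / 2) ^ n * 2 ^ n := h3
        _ ≤ (1 / 2) ^ n * 2 ^ m := by gcongr; norm_num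
  have hvd : IsDisjointSeq v := fun n m hnm => by
    rw [abs_of_nonneg (hv0 n), abs_of_nonneg (hv0 m)]
    rcases hnm.lt_or_gt with h | h
    · exact hvlt n m h
    · rw [inf_comm]
      exact hvlt m n h
  have hv1 : ∀ n, ‖v n‖ ≤ 1 := fun n => (HasSolidNorm.solid (by
    rw [abs_of_nonneg (hv0 n), abs_of_nonneg (hx0 n)]; exact hvx n)).trans (hx1 n)
  let g : ℕ → StrongDual ℝ E := fun n => G ((4 : ℝ) ^ n • s n)
  have hgB : ∀ n, g n ∈ B := fun n => hGB _ (h4s n)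
  obtain ⟨C, hC⟩ := hbdd.exists_norm_le
  have hle : ∀ n, η ≤ |g n| (v n) + (1 / 2 : ℝ) ^ n * (C * ‖T‖) := fun n => by
    have h1 : (x n - (4 : ℝ) ^ n • s n)⁺ ≤ v n + (1 / 2 : ℝ) ^ n • T := by
      refine sup_le ?_ (add_nonneg (hv0 n) (smul_nonneg (by positivity) hT0))
      exact sub_le_iff_le_add.1 (le_posPart (x n - (4 : ℝ) ^ n • s n - (1 / 2 : ℝ) ^ n • T))
    have h2 := (hG _ (h4s n)).le.trans (dual_mono (abs_nonneg (g n)) h1)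
    rw [map_add, map_smul, smul_eq_mul] at h2
    have h3 : |g n| T ≤ C * ‖T‖ := (abs_dual_apply_le_norm (g n) hT0).trans
      (mul_le_mul_of_nonneg_right (hC _ (hgB n)) (norm_nonneg T))
    exact h2.trans (add_le_add_right (mul_le_mul_of_nonneg_left h3 (by positivity)) _)
  have hlim : Tendsto (fun n => |g n| (v n) + (1 / 2 : ℝ) ^ n * (C * ‖T‖)) atTop (𝓝 0) := by
    simpa using (hB v hv0 hvd hv1 g hgB).add
      ((tendsto_pow_atTop_nhds_zero_of_lt_one (r := (1 / 2 : ℝ)) (by norm_num)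
        (by norm_num)).mul_const (C * ‖T‖))
  exact hη.not_ge (ge_of_tendsto' hlim hle)

theorem IsAlmostLSet.isLWeaklyCompact (hE : HasOrderContinuousNorm (StrongDual ℝ E))
    {B : Set (StrongDual ℝ E)} (hB : IsAlmostLSet B) : IsLWeaklyCompact B := by
  refine ⟨hB.1, fun f hf hfB => ?_⟩
  have hP : ∀ x : ℕ → E, (∀ n, 0 ≤ x n) → IsDisjointSeq x → (∀ n, ‖x n‖ ≤ 1) →
      ∀ g : ℕ → StrongDual ℝ E, (∀ n, g n ∈ B) → Tendsto (fun n => |g n| (x n)) atTop (𝓝 0) :=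
    fun x hx hd h1 g hg => hB.tendsto_abs_apply hE hx hd h1 hg
  by_contra hcon
  obtain ⟨ε, hε, hfreq⟩ : ∃ ε > 0, ∃ᶠ n in atTop, ε ≤ ‖f n‖ := by
    rw [Metric.tendsto_nhds] at hcon
    push Not at hcon
    obtain ⟨ε, hε, h⟩ := hcon
    refine ⟨ε, hε, h.mono fun n hn => ?_⟩
    simpa using hn
  obtain ⟨φ, hφ, hεφ⟩ := extraction_of_frequently_atTop hfreq
  obtain ⟨u, hu, happ⟩ := exists_forall_abs_apply_posPart_sub_le hB.1 hP
    (show 0 < ε / 4 by positivity)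
  choose g hgB hfg using hfB
  obtain ⟨C, hC⟩ := hB.1.exists_norm_le
  have hfg' : ∀ n y, 0 ≤ y → |f n| y ≤ |g n| y := fun n y hy => hfg n y hy
  -- Some `x` in the positive unit ball has value above `ε / 2`, and its excess over `u` contributes
  -- at most `ε / 4`.
  have hfu : ∀ n, ε / 4 ≤ |f (φ n)| u := fun n => by
    obtain ⟨x, hx0, hx1, hx⟩ := exists_nonneg_apply_gt (f (φ n)) (c := ε / 2) (by positivity)
      ((half_lt_self hε).trans_le (hεφ n))
    have h1 : |f (φ n)| x ≤ |f (φ n)| (u + (x - u)⁺) :=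
      dual_mono (abs_nonneg _) (sub_le_iff_le_add'.1 (le_posPart (x - u)))
    have h2 := (hfg' (φ n) _ (posPart_nonneg (x - u))).trans (happ x hx0 hx1 _ (hgB (φ n)))
    rw [map_add] at h1
    linarith
  obtain ⟨n, x, hxd, hx⟩ := exists_isDisjointSeq_of_disjoint_functionals
    (f := fun n => |f (φ n)|) (fun n => abs_nonneg _)
    (fun n m hnm => hf _ _ (hφ.injective.ne hnm)) hu (M := C * ‖u‖)
    (fun n => (hfg' _ u hu).trans ((abs_dual_apply_le_norm _ hu).trans
      (mul_le_mul_of_nonneg_right (hC _ (hgB _)) (norm_nonneg u))))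
    (show 0 < ε / 4 by positivity) hfu
  have hlim := hB.tendsto_abs_apply hE (fun k => (hx k).1) hxd (C := ‖u‖)
    (fun k => HasSolidNorm.solid (by
      rw [abs_of_nonneg (hx k).1, abs_of_nonneg hu]; exact (hx k).2.1))
    (fun k => hgB (φ (n k)))
  have hge : ∀ k, ε / 4 / 4 ≤ |g (φ (n k))| (x k) := fun k =>
    (hx k).2.2.trans (hfg' _ _ (hx k).1)
  exact (show (0 : ℝ) < ε / 4 / 4 by positivity).not_ge (ge_of_tendsto' hlim hge)

end LWeaklyCompact

/-! ### Order continuity from L-weakly compact singletons -/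

section OrderContinuous

variable {E : Type*} [NormedAddCommGroup E] [NormedSpace ℝ E] [Lattice E]

theorem isAlmostLSet_singleton (f : StrongDual ℝ E) : IsAlmostLSet {f} := by
  refine ⟨Bornology.isBounded_singleton, fun x _ hw => ?_⟩
  rw [tendstoUniformlyOn_singleton_iff_tendsto]
  exact isWeaklyNull_iff.1 hw f

variable [HasSolidNorm E] [IsOrderedAddMonoid E] [IsOrderedModule ℝ E]

/-- If order bounded disjoint sequences in the dual are norm null, then decreasing sequences of
positive functionals have small steps. -/
theorem exists_norm_sub_succ_le
    (hdisj : ∀ f : StrongDual ℝ E, IsLWeaklyCompact {f}) {g : ℕ → StrongDual ℝ E}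
    (hg : Antitone g) (hpos : ∀ n, 0 ≤ g n) {ε : ℝ} (hε : 0 < ε) :
    ∃ n, ‖g n - g (n + 1)‖ ≤ ε := by
  by_contra! hcon
  have he : ∀ n, 0 ≤ g n - g (n + 1) := fun n => sub_nonneg.2 (hg n.le_succ)
  have hx : ∀ n, ∃ x, 0 ≤ x ∧ ‖x‖ ≤ 1 ∧ ε < |g n - g (n + 1)| x := fun n =>
    exists_nonneg_apply_gt _ hε.le (hcon n)
  choose x hx0 hx1 hx using hx
  have hnorm : ∀ (h : StrongDual ℝ E) n, h (x n) ≤ ‖h‖ := fun h n =>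
    (le_abs_self _).trans ((h.le_opNorm (x n)).trans
      (mul_le_of_le_one_right (norm_nonneg h) (hx1 n)))
  -- The differences telescope to at most `g 0`, so they are themselves a packing for every finite
  -- `J`, tested by evaluation at `x n`.
  obtain ⟨n, f, hfd, hf⟩ := exists_isDisjointSeq_of_packing
    (f := fun n => (topDualPairing ℝ E).flip (x n)) (fun n h hh => dual_apply_nonneg hh (hx0 n)) (hpos 0)
    (fun n => hnorm (g 0) n) hε fun J => by
      refine ⟨fun n => g n - g (n + 1), fun i _ => he i, ?_, fun i _ => ?_⟩
      · obtain ⟨N, hN⟩ := J.exists_nat_subset_range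
        refine (Finset.sum_le_sum_of_subset_of_nonneg hN fun i _ _ => he i).trans ?_
        rw [Finset.sum_range_sub']
        exact sub_le_self _ (hpos N)
      · have := hx i
        rw [abs_of_nonneg (he i)] at this
        exact this.le
  have hlim := (hdisj (g 0)).2 f hfd fun k => ⟨g 0, rfl, by
    rw [abs_of_nonneg (hf k).1, abs_of_nonneg (hpos 0)]; exact (hf k).2.1⟩
  exact (half_pos hε).not_ge (ge_of_tendsto' hlim fun k => (hf k).2.2.trans (hnorm (f k) (n k)))

theorem hasOrderContinuousNorm_dual (hdisj : ∀ f : StrongDual ℝ E, IsLWeaklyCompact {f}) :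
    HasOrderContinuousNorm (StrongDual ℝ E) := by
  intro D hne hdir hglb
  have hpos : ∀ g ∈ D, 0 ≤ g := fun g hg => hglb.1 hg
  -- Otherwise iteration yields a decreasing sequence in `D` whose steps all exceed `ε` in norm.
  have hsmall : ∀ ε > 0, ∃ g ∈ D, ∀ h ∈ D, h ≤ g → ‖g - h‖ ≤ ε := by
    intro ε hε
    by_contra! hcon
    choose! next hD hle hlt using hcon
    obtain ⟨g₀, hg₀⟩ := hne
    let g : ℕ → StrongDual ℝ E := fun n => next^[n] g₀
    have hsucc : ∀ n, g (n + 1) = next (g n) := fun n => Function.iterate_succ_apply' next n g₀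
    have hgD : ∀ n, g n ∈ D := fun n => by
      induction n with
      | zero => exact hg₀
      | succ n ih => exact hsucc n ▸ hD _ ih
    obtain ⟨n, hn⟩ := exists_norm_sub_succ_le hdisj
      (antitone_nat_of_succ_le fun n => hsucc n ▸ hle _ (hgD n)) (fun n => hpos _ (hgD n)) hε
    rw [hsucc] at hn
    exact (hlt _ (hgD n)).not_ge hn
  obtain ⟨H, hH0, hH, hlt⟩ := exists_isGLB_dual hne hdir hpos
  have hHle : H ≤ 0 := hglb.2 fun g hg => hH g hg
  refine ⟨by rintro _ ⟨g, -, rfl⟩; exact norm_nonneg g, fun c hc => ?_⟩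
  refine le_of_forall_pos_le_add fun ε hε => ?_
  obtain ⟨g, hg, hgε⟩ := hsmall ε hε
  rw [zero_add]
  refine (hc ⟨g, hg, rfl⟩).trans (norm_dual_le_of_forall_nonneg g hε.le fun x hx => ?_)
  rw [abs_of_nonneg (hpos g hg)]
  refine le_of_forall_pos_le_add fun η hη => ?_
  obtain ⟨k, hk, hkη⟩ := hlt x hx η hη
  -- Below both `g` and `k`, so `g x = (g - h) x + h x ≤ ε * ‖x‖ + η`.
  obtain ⟨h, hh, hhg, hhk⟩ := hdir g hg k hk
  have h1 : (g - h) x ≤ ε * ‖x‖ := (le_abs_self _).trans (((g - h).le_opNorm x).trans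
    (mul_le_mul_of_nonneg_right (hgε h hh hhg) (norm_nonneg x)))
  have h2 : (g - h) x = g x - h x := rfl
  have h3 : h x ≤ k x := hhk x hx
  have h4 : H x ≤ 0 := hHle x hx
  linarith

end OrderContinuous

end BanachLattice

theorem lemma2p9 (E : Type*) [NormedAddCommGroup E] [NormedSpace ℝ E] [CompleteSpace E]
    [Lattice E] [HasSolidNorm E] [IsOrderedAddMonoid E] [IsOrderedModule ℝ E] :
    (∀ B : Set (StrongDual ℝ E),
        BanachLattice.IsAlmostLSet B → BanachLattice.IsLWeaklyCompact B) ↔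
      BanachLattice.HasOrderContinuousNorm (StrongDual ℝ E) := by
  refine ⟨fun h => BanachLattice.hasOrderContinuousNorm_dual fun f =>
    h {f} (BanachLattice.isAlmostLSet_singleton f), fun h B hB => hB.isLWeaklyCompact h⟩
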